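/- For a positive integer $k$ let $f_k=(q^k;q^k)_\infty=\prod_{m\ge 1}(1-q^{km})$, where $(a;q)_\infty=\prod_{n\ge 0}(1-aq^n)$. For a positive integer $t$ define the integers $w_t(n)$, $n\ge 0$, by $$\sum_{n=0}^\infty w_t(n)q^n=\frac{(q^2;q^2)_\infty}{(q;q^2)_\infty^4\,(q^t;q^t)_\infty^2}.$$ If $t\equiv 0\pmod 3$, then, as identities of formal power series in $q$ with integer coefficients, $$\sum_{n=0}^\infty w_t(3n)q^n=\frac{f_2^4f_3^4f_6}{f_1^8f_{t/3}^2}\left(\frac{f_2^2f_3^6}{f_1^2f_6^6}+10q\,\frac{f_1f_6^3}{f_2f_3^3}\right),$$ $$\sum_{n=0}^\infty w_t(3n+1)q^n=4\,\frac{f_2^4f_3^4f_6}{f_1^8f_{t/3}^2}\left(\frac{f_2f_3^3}{f_1f_6^3}+q\,\frac{f_1^2f_6^6}{f_2^2f_3^6}\right),$$ $$\sum_{n=0}^\infty w_t(3n+2)q^n=9\,\frac{f_2^4f_3^4f_6}{f_1^8f_{t/3}^2}.$$ Consequently, for all $n\ge 0$, $w_t(3n+1)\equiv 0\pmod 4$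 and $w_t(3n+2)\equiv 0\pmod 9$. -/

import Mathlib

open PowerSeries
open scoped PowerSeries.WithPiTopology Ring

namespace SevenColored

/-- The `q`-Pochhammer symbol `(a; b)_∞ = ∏_{n ≥ 0} (1 - a b^n)` in `ℤ⟦X⟧`; the infinite product is
taken in the topology of coefficientwise convergence (`ℤ` being discrete). -/
noncomputable def qPoch (a b : ℤ⟦X⟧) : ℤ⟦X⟧ := ∏' n : ℕ, (1 - a * b ^ n)

/-- `f_k = (q^k; q^k)_∞`. -/
noncomputable def f (k : ℕ) : ℤ⟦X⟧ := qPoch (X ^ k) (X ^ k)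

/-- The generating function `(q²; q²)_∞ / ((q; q²)_∞⁴ (q^t; q^t)_∞²)`. Here `A⁻¹ʳ` is the inverse of
`A` in the ring `ℤ⟦X⟧`; `isUnit_qPoch` and `isUnit_f` show that the denominators are units. -/
noncomputable def wGen (t : ℕ) : ℤ⟦X⟧ :=
  qPoch (X ^ 2) (X ^ 2) * (qPoch X (X ^ 2) ^ 4 * qPoch (X ^ t) (X ^ t) ^ 2)⁻¹ʳ

/-- The weighted number `w_t(n)` of 7-colored partitions of `n`. -/
noncomputable def w (t n : ℕ) : ℤ := coeff n (wGen t)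

/-- The infinite product converges whenever `j, k ≥ 1`. -/
theorem multipliable_qPoch {j k : ℕ} (hj : 0 < j) (hk : 0 < k) :
    Multipliable fun n : ℕ ↦ (1 : ℤ⟦X⟧) - X ^ j * (X ^ k) ^ n := by
  simp_rw [sub_eq_add_neg]
  apply WithPiTopology.multipliable_one_add_of_tendsto_order_atTop_nhds_top
  refine ENat.tendsto_nhds_top_iff_natCast_lt.mpr fun n ↦ Filter.eventually_atTop.mpr ⟨n, ?_⟩
  intro m hm
  rw [order_neg, ← pow_mul, ← pow_add, order_X_pow]
  norm_cast
  nlinarith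

theorem constantCoeff_qPoch {j k : ℕ} (hj : 0 < j) (hk : 0 < k) :
    constantCoeff (qPoch (X ^ j) (X ^ k)) = 1 := by
  rw [qPoch, (multipliable_qPoch hj hk).map_tprod _ (WithPiTopology.continuous_constantCoeff ℤ)]
  simp [hj.ne']

theorem isUnit_qPoch {j k : ℕ} (hj : 0 < j) (hk : 0 < k) : IsUnit (qPoch (X ^ j) (X ^ k)) := by
  rw [isUnit_iff_constantCoeff, constantCoeff_qPoch hj hk]
  exact isUnit_one

theorem isUnit_f {k : ℕ} (hk : 0 < k) : IsUnit (f k) := isUnit_qPoch hk hk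

end SevenColored

open SevenColored

/-! Since `(q;q²)_∞ = f₁/f₂`, the generating function is `f₂⁵/(f₁⁴ f_t²)`, and `f_t` is a series in
`q³` when `3 ∣ t`; it remains to 3-dissect `f₂⁵/f₁⁴ = (f₂²/f₁)² · (f₂/f₁²)`. Put `U = f₆f₉³` and `V
= q f₃f₁₈³`. Up to factors in `q³`, the theta series `f₂²/f₁` is `U + V` (`f_two_sq_dissection`) and
`f₁²/f₂` is `U - 2V` (`f_one_sq_dissection`). Both follow from the Jacobi triple product by
splitting the sum over `ℤ` into residue classes.

To invert `U - 2V`, multiply it by its conjugates under `q ↦ ωq`, `ω³ = 1`: the norm `U³ - 8V³` is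
an eta quotient in `q³` (`f_three_pow_mul_eq_sub`). Hence `f₂⁵/f₁⁴` is, up to a factor in `q³`,
`(U+V)²(U²+2UV+4V²) = U⁴ + 4U³V + 9U²V² + 10UV³ + 4V⁴`. Since `V` is `q` times a series in `q³`,
sorting by the power of `V` mod 3 gives the three formulas; the congruences are the factors 4 and 9.
-/

/-! ### Gaussian binomials and the finite Jacobi triple product. -/

/-- The Gaussian binomial coefficient `[n choose k]` at `q`. -/
def gaussBinom {R : Type*} [CommRing R] (q : R) : ℕ → ℕ → R
  | _, 0 => 1
  | 0, _ + 1 => 0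
  | n + 1, k + 1 => gaussBinom q n k + q ^ (k + 1) * gaussBinom q n (k + 1)

section GaussBinom

variable {R : Type*} [CommRing R] (q : R)

@[simp] theorem gaussBinom_zero_right (n : ℕ) : gaussBinom q n 0 = 1 := by
  cases n <;> simp [gaussBinom]

theorem gaussBinom_succ_succ (n k : ℕ) :
    gaussBinom q (n + 1) (k + 1) = gaussBinom q n k + q ^ (k + 1) * gaussBinom q n (k + 1) := by
  simp [gaussBinom]

theorem gaussBinom_eq_zero_of_lt {n k : ℕ} (h : n < k) : gaussBinom q n k = 0 := by
  induction n generalizing k with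
  | zero => cases k with
    | zero => omega
    | succ k => simp [gaussBinom]
  | succ n ih => cases k with
    | zero => omega
    | succ k => rw [gaussBinom_succ_succ, ih (by omega), ih (by omega)]; simp

@[simp] theorem gaussBinom_self (n : ℕ) : gaussBinom q n n = 1 := by
  induction n with
  | zero => simp
  | succ n ih => rw [gaussBinom_succ_succ, ih, gaussBinom_eq_zero_of_lt q (by omega)]; simp

/-- The finite product `(q; q)_n`. -/
def qFactorial (n : ℕ) : R := ∏ i ∈ Finset.range n, (1 - q ^ (i + 1))

theorem qFactorial_succ (n : ℕ) : qFactorial q (n + 1) = qFactorial q n * (1 - q ^ (n + 1)) :=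
  Finset.prod_range_succ _ _

theorem gaussBinom_mul_qFactorial (m k : ℕ) :
    gaussBinom q (m + k) k * (qFactorial q m * qFactorial q k) = qFactorial q (m + k) := by
  induction k generalizing m with
  | zero => simp [qFactorial]
  | succ k ihk => induction m with
    | zero => simp [qFactorial]
    | succ m ihm =>
      have h1 := ihk (m + 1)
      have e1 : m + 1 + (k + 1) = (m + 1 + k) + 1 := by ring
      have e2 : m + (k + 1) = m + 1 + k := by ring
      rw [e2] at ihm
      rw [e1, gaussBinom_succ_succ, qFactorial_succ q (m + 1 + k)]
      rw [qFactorial_succ q m] at h1 ⊢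
      rw [qFactorial_succ q k] at ihm ⊢
      have e3 : q ^ (m + 1 + k + 1) = q ^ (m + 1) * q ^ (k + 1) := by rw [← pow_add]; ring_nf
      rw [e3]
      -- The last factor splits as `1 - q^(m+k+2) = (1 - q^(k+1)) + q^(k+1) (1 - q^(m+1))`, matching
      -- the two terms of the Pascal recurrence.
      linear_combination (1 - q ^ (k + 1)) * h1 + q ^ (k + 1) * (1 - q ^ (m + 1)) * ihm

/-- The `q`-binomial theorem in homogeneous form. -/
theorem prod_add_mul_pow_eq_sum_gaussBinom (m : ℕ) (x y : R) :
    ∏ i ∈ Finset.range m, (y + x * q ^ i) =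
      ∑ k ∈ Finset.range (m + 1), gaussBinom q m k * q ^ (k.choose 2) * x ^ k * y ^ (m - k) := by
  induction m generalizing x with
  | zero => simp
  | succ m ih =>
    -- Peeling off the factor `i = 0` leaves the same product with `x * q` in place of `x`, hence
    -- the induction over all `x`.
    have h : ∀ i, y + x * q ^ (i + 1) = y + (x * q) * q ^ i := fun i ↦ by ring
    rw [Finset.prod_range_succ', Finset.prod_congr rfl fun i _ ↦ h i, ih, mul_add, Finset.sum_mul,
      Finset.sum_mul, Finset.sum_range_succ' _ (m + 1)]
    have h1 : ∑ k ∈ Finset.range (m + 1),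
        gaussBinom q m k * q ^ (k.choose 2) * (x * q) ^ k * y ^ (m - k) * y =
        ∑ k ∈ Finset.range (m + 1), q ^ (k + 1) * gaussBinom q m (k + 1) *
          q ^ ((k + 1).choose 2) * x ^ (k + 1) * y ^ (m - k) + y ^ (m + 1) := by
      rw [Finset.sum_range_succ', Finset.sum_range_succ _ m, gaussBinom_eq_zero_of_lt q (by omega :
        m < m + 1)]
      simp only [mul_zero, zero_mul, add_zero]
      congr 1
      · refine Finset.sum_congr rfl fun k hk ↦ ?_
        rw [Finset.mem_range] at hk
        obtain ⟨d, rfl⟩ := Nat.exists_eq_add_of_lt hk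
        rw [show k + d + 1 - (k + 1) = d by omega, show k + d + 1 - k = d + 1 by omega]
        ring
      · simp [pow_succ]
    rw [h1, add_right_comm, ← Finset.sum_add_distrib]
    congr 1
    · refine Finset.sum_congr rfl fun k _ ↦ ?_
      rw [gaussBinom_succ_succ, show m + 1 - (k + 1) = m - k by omega, Nat.choose_succ_succ k 1,
        Nat.choose_one_right]
      ring
    · simp

/-- The finite products `(q; q)_n` stabilise modulo high powers of `q`. -/
theorem dvd_qFactorial_sub_qFactorial {x : R} (hx : x ∣ q) {n m : ℕ} (h : n ≤ m) :
    x ^ n ∣ qFactorial q m - qFactorial q n := by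
  induction m, h using Nat.le_induction with
  | base => simp
  | succ m hm ih =>
    rw [qFactorial_succ]
    have : x ^ n ∣ q ^ (m + 1) := (pow_dvd_pow x (by omega)).trans (pow_dvd_pow_of_dvd hx _)
    have h2 := dvd_sub ih (this.mul_left (qFactorial q m))
    convert h2 using 1
    ring

end GaussBinom

theorem isUnit_qFactorial {q : ℤ⟦X⟧} (hq : X ∣ q) (n : ℕ) : IsUnit (qFactorial q n) := by
  rw [isUnit_iff_constantCoeff, qFactorial, map_prod]
  rw [X_dvd_iff] at hq
  simp [hq]

/-- Modulo `X ^ n` all `(q;q)_j` with `j ≥ n` equal the unit `(q;q)_n`, so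
`gaussBinom_mul_qFactorial` can be cancelled. This is the passage to the limit in the central
binomials of the finite triple product. -/
theorem X_pow_dvd_qFactorial_mul_gaussBinom_sub_one {q : ℤ⟦X⟧} (hq : X ∣ q) {n m k l : ℕ}
    (hm : n ≤ m) (hk : n ≤ k) (hl : n ≤ l) :
    X ^ n ∣ qFactorial q l * gaussBinom q (m + k) k - 1 := by
  have key (j : ℕ) (hj : n ≤ j) : Ideal.Quotient.mk (Ideal.span {(X : ℤ⟦X⟧) ^ n}) (qFactorial q j) =
      Ideal.Quotient.mk (Ideal.span {(X : ℤ⟦X⟧) ^ n}) (qFactorial q n) := by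
    rw [Ideal.Quotient.eq, Ideal.mem_span_singleton]
    exact dvd_qFactorial_sub_qFactorial q hq hj
  have h := congrArg (Ideal.Quotient.mk (Ideal.span {(X : ℤ⟦X⟧) ^ n}))
    (gaussBinom_mul_qFactorial q m k)
  have hu := (isUnit_qFactorial hq n).map (Ideal.Quotient.mk (Ideal.span {(X : ℤ⟦X⟧) ^ n}))
  rw [← Ideal.mem_span_singleton, ← Ideal.Quotient.eq, map_mul, map_one, key l hl]
  rw [map_mul, map_mul, key m hm, key k hk, key (m + k) (by omega)] at h
  refine hu.mul_left_cancel ?_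
  linear_combination h

theorem two_mul_choose_two (k : ℕ) : 2 * ((k.choose 2 : ℕ) : ℤ) = k * (k - 1) := by
  induction k with
  | zero => simp
  | succ k ih =>
    rw [Nat.choose_succ_succ k 1, Nat.choose_one_right]
    push_cast
    linarith

/-- A finite form of the Jacobi triple product identity. -/
theorem prod_mul_prod_eq_sum_gaussBinom (u : ℤ⟦X⟧ˣ) {a b M : ℕ} (hab : a + b = M) {e : ℤ → ℕ}
    (he : ∀ l : ℤ, 2 * (e l : ℤ) = M * (l * (l - 1)) + 2 * a * l) (N : ℕ) :
    (∏ j ∈ Finset.range N, (1 + (u : ℤ⟦X⟧) * X ^ a * (X ^ M) ^ j)) *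
      ∏ j ∈ Finset.range N, (1 + ((u⁻¹ : ℤ⟦X⟧ˣ) : ℤ⟦X⟧) * X ^ b * (X ^ M) ^ j) =
    ∑ k ∈ Finset.range (2 * N + 1), gaussBinom ((X : ℤ⟦X⟧) ^ M) (2 * N) k *
      (((u ^ ((k : ℤ) - N) : ℤ⟦X⟧ˣ) : ℤ⟦X⟧) * X ^ e (k - N)) := by
  have h := prod_add_mul_pow_eq_sum_gaussBinom ((X : ℤ⟦X⟧) ^ M) (2 * N) ((u : ℤ⟦X⟧) * X ^ a)
    ((X ^ M) ^ N)
  -- With `y = X^(MN)`, each of the first `N` factors, read in reverse, has `u X^a X^(M(N-1-j))`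
  -- taken out, and each of the last `N` has `X^(MN)`; `c` is the total exponent of `X`.
  set c := M * (N.choose 2 + N * N) + a * N with hc
  have h1 : ∏ i ∈ Finset.range (2 * N), ((X ^ M) ^ N + (u : ℤ⟦X⟧) * X ^ a * ((X : ℤ⟦X⟧) ^ M) ^ i) =
      (u : ℤ⟦X⟧) ^ N * X ^ c * ((∏ j ∈ Finset.range N, (1 + (u : ℤ⟦X⟧) * X ^ a * (X ^ M) ^ j)) *
      ∏ j ∈ Finset.range N, (1 + ((u⁻¹ : ℤ⟦X⟧ˣ) : ℤ⟦X⟧) * X ^ b * (X ^ M) ^ j)) := by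
    rw [two_mul, Finset.prod_range_add, ← Finset.prod_range_reflect]
    have h2 : ∀ j ∈ Finset.range N, (X ^ M) ^ N + (u : ℤ⟦X⟧) * X ^ a * ((X : ℤ⟦X⟧) ^ M) ^ (N - 1 - j) =
        ((u : ℤ⟦X⟧) * X ^ a) * (X ^ M) ^ (N - 1 - j) * (1 + ((u⁻¹ : ℤ⟦X⟧ˣ) : ℤ⟦X⟧) * X ^ b * (X ^ M) ^ j) := by
      intro j hj
      rw [Finset.mem_range] at hj
      have h3 : ((X : ℤ⟦X⟧) ^ M) ^ N = X ^ a * X ^ b * (X ^ M) ^ (N - 1 - j) * (X ^ M) ^ j := by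
        rw [← pow_add, hab, mul_assoc, ← pow_add, ← pow_succ']
        congr 1
        omega
      have h4 : (u : ℤ⟦X⟧) * (u⁻¹ : ℤ⟦X⟧ˣ) = 1 := u.mul_inv
      rw [h3]
      linear_combination (-X ^ a * X ^ b * (X ^ M) ^ (N - 1 - j) * (X ^ M) ^ j) * h4
    have h5 : ∀ j ∈ Finset.range N, (X ^ M) ^ N + (u : ℤ⟦X⟧) * X ^ a * ((X : ℤ⟦X⟧) ^ M) ^ (N + j) =
        (X ^ M) ^ N * (1 + (u : ℤ⟦X⟧) * X ^ a * (X ^ M) ^ j) := fun j _ ↦ by ring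
    rw [Finset.prod_congr rfl h2, Finset.prod_congr rfl h5, Finset.prod_mul_distrib,
      Finset.prod_mul_distrib, Finset.prod_mul_distrib, Finset.prod_mul_distrib, Finset.prod_const,
      Finset.prod_const, Finset.prod_const,
      Finset.prod_range_reflect (fun j ↦ ((X : ℤ⟦X⟧) ^ M) ^ j), Finset.prod_pow_eq_pow_sum,
      Finset.card_range, Finset.sum_range_id, ← Nat.choose_two_right, hc]
    ring
  rw [h1] at h
  have hX : (u : ℤ⟦X⟧) ^ N * X ^ c ≠ 0 :=
    mul_ne_zero (pow_ne_zero _ u.ne_zero) (pow_ne_zero _ X_ne_zero)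
  refine mul_left_cancel₀ hX (h.trans ?_)
  rw [Finset.mul_sum]
  refine Finset.sum_congr rfl fun k hk ↦ ?_
  rw [Finset.mem_range] at hk
  have hu : (u : ℤ⟦X⟧) ^ k = u ^ N * ((u ^ ((k : ℤ) - N) : ℤ⟦X⟧ˣ) : ℤ⟦X⟧) := by
    rw [← Units.val_pow_eq_pow_val, ← Units.val_pow_eq_pow_val, ← Units.val_mul, ← zpow_natCast,
      ← zpow_natCast, ← zpow_add]
    simp
  have hexp : M * k.choose 2 + a * k + M * N * (2 * N - k) = c + e (k - N) := by
    have h3 := he (k - N)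
    have h4 := two_mul_choose_two k
    have h5 := two_mul_choose_two N
    rw [hc]
    zify [show k ≤ 2 * N by omega]
    refine mul_left_cancel₀ (two_ne_zero (α := ℤ)) ?_
    linear_combination M * h4 - M * h5 - h3
  have hX2 : ((X : ℤ⟦X⟧) ^ M) ^ k.choose 2 * (X ^ a) ^ k * ((X ^ M) ^ N) ^ (2 * N - k) =
      X ^ c * X ^ e (k - N) := by
    rw [← pow_add, ← hexp]
    simp only [← pow_mul, ← pow_add]
  rw [mul_pow, hu]
  linear_combination gaussBinom (X ^ M) (2 * N) k * (u : ℤ⟦X⟧) ^ N *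
    ((u ^ ((k : ℤ) - N) : ℤ⟦X⟧ˣ) : ℤ⟦X⟧) * hX2

/-! ### Infinite products. -/

open Filter Topology

section QPochhammer

variable {R : Type*} [CommRing R] [TopologicalSpace R]

theorem multipliable_one_sub_mul_pow {a b : R⟦X⟧} (ha : X ∣ a) (hb : X ∣ b) :
    Multipliable fun n : ℕ ↦ 1 - a * b ^ n := by
  simp_rw [sub_eq_add_neg]
  apply WithPiTopology.multipliable_one_add_of_tendsto_order_atTop_nhds_top
  refine ENat.tendsto_nhds_top_iff_natCast_lt.mpr fun n ↦ eventually_atTop.mpr ⟨n, fun m hm ↦ ?_⟩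
  have h : (X : R⟦X⟧) ^ (m + 1) ∣ -(a * b ^ m) := by
    rw [dvd_neg, pow_succ']
    exact mul_dvd_mul ha (pow_dvd_pow_of_dvd hb m)
  rw [X_pow_dvd_iff] at h
  refine lt_of_lt_of_le ?_ (nat_le_order _ (m + 1) h)
  exact_mod_cast Nat.lt_succ_of_le hm

theorem tendsto_prod_one_sub_mul_pow {a b : ℤ⟦X⟧} (ha : X ∣ a) (hb : X ∣ b) :
    Tendsto (fun N ↦ ∏ n ∈ Finset.range N, (1 - a * b ^ n)) atTop (𝓝 (qPoch a b)) :=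
  (multipliable_one_sub_mul_pow ha hb).hasProd.tendsto_prod_nat

theorem qPoch_mul_qPoch_neg {a b : ℤ⟦X⟧} (ha : X ∣ a) (hb : X ∣ b) :
    qPoch a b * qPoch (-a) b = qPoch (a ^ 2) (b ^ 2) := by
  rw [qPoch, qPoch, qPoch, ← (multipliable_one_sub_mul_pow ha hb).tprod_mul
    (multipliable_one_sub_mul_pow (ha.neg_right) hb)]
  refine tprod_congr fun n ↦ ?_
  ring

theorem prod_range_mul_eq_prod_prod {M : Type*} [CommMonoid M] (g : ℕ → M) (r N : ℕ) :
    ∏ n ∈ Finset.range (r * N), g n =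
      ∏ i ∈ Finset.range r, ∏ n ∈ Finset.range N, g (r * n + i) := by
  induction N with
  | zero => simp
  | succ N ih =>
    rw [mul_add_one, Finset.prod_range_add, ih, ← Finset.prod_mul_distrib]
    exact Finset.prod_congr rfl fun i _ ↦ (Finset.prod_range_succ _ _).symm

/-- The factors are grouped by their index mod `r`; partial products are compared along multiples of
`r`. -/
theorem qPoch_eq_prod {a b : ℤ⟦X⟧} (ha : X ∣ a) (hb : X ∣ b) {r : ℕ} (hr : 0 < r) :
    qPoch a b = ∏ i ∈ Finset.range r, qPoch (a * b ^ i) (b ^ r) := by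
  have h1 : Tendsto (fun N ↦ ∏ n ∈ Finset.range (r * N), (1 - a * b ^ n)) atTop
      (𝓝 (qPoch a b)) :=
    (tendsto_prod_one_sub_mul_pow ha hb).comp (tendsto_id.const_mul_atTop' hr)
  have h2 : Tendsto (fun N ↦ ∏ i ∈ Finset.range r, ∏ n ∈ Finset.range N,
      (1 - (a * b ^ i) * (b ^ r) ^ n)) atTop
      (𝓝 (∏ i ∈ Finset.range r, qPoch (a * b ^ i) (b ^ r))) :=
    tendsto_finsetProd _ fun i _ ↦
      tendsto_prod_one_sub_mul_pow (ha.mul_right _) (dvd_pow hb hr.ne')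
  refine tendsto_nhds_unique h1 (h2.congr fun N ↦ ?_)
  rw [prod_range_mul_eq_prod_prod]
  refine Finset.prod_congr rfl fun i _ ↦ Finset.prod_congr rfl fun n _ ↦ ?_
  ring

theorem qPoch_eq_mul {a b : ℤ⟦X⟧} (ha : X ∣ a) (hb : X ∣ b) :
    qPoch a b = qPoch a (b ^ 2) * qPoch (a * b) (b ^ 2) := by
  simp [qPoch_eq_prod ha hb Nat.two_pos, Finset.prod_range_succ]

theorem qPoch_eq_mul_mul {a b : ℤ⟦X⟧} (ha : X ∣ a) (hb : X ∣ b) :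
    qPoch a b = qPoch a (b ^ 3) * qPoch (a * b) (b ^ 3) * qPoch (a * b ^ 2) (b ^ 3) := by
  simp [qPoch_eq_prod ha hb (Nat.succ_pos 2), Finset.prod_range_succ]

end QPochhammer

/-! ### The Jacobi triple product. -/

/-- The product side of the Jacobi triple product identity. -/
noncomputable def jacobiProd (u : ℤ⟦X⟧ˣ) (a b : ℕ) : ℤ⟦X⟧ :=
  f (a + b) * qPoch (-((u : ℤ⟦X⟧) * X ^ a)) (X ^ (a + b)) *
    qPoch (-(((u⁻¹ : ℤ⟦X⟧ˣ) : ℤ⟦X⟧) * X ^ b)) (X ^ (a + b))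

/-- For negative `l` the exponent equals `(a+b) l(l+1)/2 + b|l|`. The bound leaves finitely many
terms in each degree. -/
theorem natAbs_le_of_two_mul_eq {a b : ℕ} (ha : 0 < a) (hb : 0 < b) {e : ℕ} {l : ℤ}
    (he : 2 * (e : ℤ) = (a + b : ℕ) * (l * (l - 1)) + 2 * a * l) : l.natAbs ≤ e := by
  push_cast at he
  have ha' : (1 : ℤ) ≤ a := by exact_mod_cast ha
  have hb' : (1 : ℤ) ≤ b := by exact_mod_cast hb
  zify
  rcases le_or_gt 0 l with h | h
  · rw [abs_of_nonneg h]
    have h1 : 0 ≤ l * (l - 1) := by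
      rcases h.eq_or_lt with h | h
      · simp [← h]
      · exact mul_nonneg h.le (by omega)
    nlinarith
  · rw [abs_of_neg h]
    have h1 : 0 ≤ l * (l + 1) := mul_nonneg_of_nonpos_of_nonpos h.le (by omega)
    nlinarith

/-- The Jacobi triple product identity. -/
theorem hasSum_jacobiProd (u : ℤ⟦X⟧ˣ) {a b : ℕ} (ha : 0 < a) (hb : 0 < b) {e : ℤ → ℕ}
    (he : ∀ l : ℤ, 2 * (e l : ℤ) = (a + b : ℕ) * (l * (l - 1)) + 2 * a * l) :
    HasSum (fun l : ℤ ↦ ((u ^ l : ℤ⟦X⟧ˣ) : ℤ⟦X⟧) * X ^ e l) (jacobiProd u a b) := by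
  have hM : (X : ℤ⟦X⟧) ∣ X ^ (a + b) := dvd_pow_self _ (by omega)
  have hlim : Tendsto (fun N ↦ qFactorial ((X : ℤ⟦X⟧) ^ (a + b)) N *
      ((∏ j ∈ Finset.range N, (1 + (u : ℤ⟦X⟧) * X ^ a * (X ^ (a + b)) ^ j)) *
      ∏ j ∈ Finset.range N, (1 + ((u⁻¹ : ℤ⟦X⟧ˣ) : ℤ⟦X⟧) * X ^ b * (X ^ (a + b)) ^ j)))
      atTop (𝓝 (jacobiProd u a b)) := by
    rw [jacobiProd, mul_assoc]
    refine Tendsto.mul ?_ (Tendsto.mul ?_ ?_)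
    · refine (tendsto_prod_one_sub_mul_pow hM hM).congr fun N ↦ ?_
      simp_rw [qFactorial, pow_succ' (X ^ (a + b) : ℤ⟦X⟧)]
    · refine (tendsto_prod_one_sub_mul_pow (((dvd_pow_self X ha.ne').mul_left (u : ℤ⟦X⟧)).neg_right)
        hM).congr fun N ↦ ?_
      simp only [neg_mul, sub_neg_eq_add]
    · refine (tendsto_prod_one_sub_mul_pow
        (((dvd_pow_self X hb.ne').mul_left ((u⁻¹ : ℤ⟦X⟧ˣ) : ℤ⟦X⟧)).neg_right)
        hM).congr fun N ↦ ?_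
      simp only [neg_mul, sub_neg_eq_add]
  rw [WithPiTopology.hasSum_iff_hasSum_coeff]
  intro d
  have hd := (((WithPiTopology.continuous_coeff ℤ d).tendsto _).comp hlim)
  rw [nhds_discrete ℤ, tendsto_pure] at hd
  -- If `e (k - N) ≤ d` then `|k - N| ≤ d`, so `N ≥ 2 (d + 1)` makes both `k` and `2N - k` at least
  -- `d + 1`, as the stabilisation of the binomials requires.
  obtain ⟨N, hN, hNd⟩ := (hd.and (eventually_ge_atTop (2 * (d + 1)))).exists
  have hdvd : X ^ (d + 1) ∣ qFactorial ((X : ℤ⟦X⟧) ^ (a + b)) N *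
      (∑ k ∈ Finset.range (2 * N + 1), gaussBinom ((X : ℤ⟦X⟧) ^ (a + b)) (2 * N) k *
      (((u ^ ((k : ℤ) - N) : ℤ⟦X⟧ˣ) : ℤ⟦X⟧) * X ^ e (k - N))) -
      ∑ k ∈ Finset.range (2 * N + 1), (((u ^ ((k : ℤ) - N) : ℤ⟦X⟧ˣ) : ℤ⟦X⟧) * X ^ e (k - N)) := by
    rw [Finset.mul_sum, ← Finset.sum_sub_distrib]
    refine Finset.dvd_sum fun k hk ↦ ?_
    rw [Finset.mem_range] at hk
    rw [← mul_assoc, ← sub_one_mul]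
    have hle := natAbs_le_of_two_mul_eq ha hb (he (k - N))
    rcases le_or_gt (d + 1) (e (k - N)) with h | h
    · exact ((pow_dvd_pow _ h).mul_left _).mul_left _
    · refine Dvd.dvd.mul_right ?_ _
      obtain ⟨m, hm⟩ : ∃ m, 2 * N = m + k := ⟨2 * N - k, by omega⟩
      rw [hm]
      exact X_pow_dvd_qFactorial_mul_gaussBinom_sub_one hM (by omega) (by omega) (by omega)
  rw [X_pow_dvd_iff] at hdvd
  have hc := hdvd d (by omega)
  rw [map_sub, sub_eq_zero, ← prod_mul_prod_eq_sum_gaussBinom u rfl he N] at hc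
  have hval := hN.symm.trans hc
  rw [map_sum] at hval
  rw [hval]
  have himg : ∑ k ∈ Finset.range (2 * N + 1), coeff d
      (((u ^ ((k : ℤ) - N) : ℤ⟦X⟧ˣ) : ℤ⟦X⟧) * X ^ e (k - N)) =
      ∑ l ∈ (Finset.range (2 * N + 1)).image (fun k : ℕ ↦ (k : ℤ) - N),
        coeff d (((u ^ l : ℤ⟦X⟧ˣ) : ℤ⟦X⟧) * X ^ e l) := by
    rw [Finset.sum_image]
    intro x _ y _ h
    simpa using h
  rw [himg]
  -- Indices outside `[-N, N]` have exponent at least `|l| > N > d`, so they do not affect degree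
  -- `d`.
  refine hasSum_sum_of_ne_finset_zero fun l hl ↦ ?_
  have hle := natAbs_le_of_two_mul_eq ha hb (he l)
  have hlN : N < l.natAbs := by
    by_contra h
    refine hl (Finset.mem_image.mpr ⟨(l + N).toNat, Finset.mem_range.mpr (by omega), by omega⟩)
  rw [coeff_mul_X_pow', if_neg (by omega)]

/-! ### Theta products as eta quotients. -/

section EtaQuotients

variable {s : ℕ}

theorem X_dvd_X_pow {j : ℕ} (hj : 0 < j) : (X : ℤ⟦X⟧) ∣ X ^ j := dvd_pow_self _ hj.ne'

theorem qPoch_X_pow_mul_f (hs : 0 < s) : qPoch (X ^ s) (X ^ (2 * s)) * f (2 * s) = f s := by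
  rw [f, f, qPoch_eq_mul (X_dvd_X_pow hs) (X_dvd_X_pow hs)]
  ring_nf

theorem qPoch_neg_X_pow_mul_f (hs : 0 < s) : qPoch (-X ^ s) (X ^ s) * f s = f (2 * s) := by
  rw [mul_comm, f, qPoch_mul_qPoch_neg (X_dvd_X_pow hs) (X_dvd_X_pow hs), f]
  ring_nf

/-- This is Ramanujan's `ψ(q^s)`. The two linear products merge into `(-q^s; q^(2s))_∞`, which turns
into eta quotients after multiplication by `(q^s; q^(2s))_∞`. -/
theorem jacobiProd_one_three (hs : 0 < s) : jacobiProd 1 (3 * s) s * f s = f (2 * s) ^ 2 := by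
  have h1 : qPoch (-X ^ s) (X ^ (2 * s)) =
      qPoch (-X ^ s) (X ^ (3 * s + s)) * qPoch (-X ^ (3 * s)) (X ^ (3 * s + s)) := by
    rw [qPoch_eq_mul (X_dvd_X_pow hs).neg_right (X_dvd_X_pow (by omega))]
    ring_nf
  have h2 : qPoch (X ^ s) (X ^ (2 * s)) * qPoch (-X ^ s) (X ^ (2 * s)) =
      qPoch (X ^ (2 * s)) (X ^ (2 * (2 * s))) := by
    rw [qPoch_mul_qPoch_neg (X_dvd_X_pow hs) (X_dvd_X_pow (by omega))]
    ring_nf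
  have h3 := qPoch_X_pow_mul_f hs
  have h4 := qPoch_X_pow_mul_f (s := 2 * s) (by omega)
  simp only [jacobiProd, Units.val_one, inv_one, one_mul]
  rw [show f (3 * s + s) = f (2 * (2 * s)) by ring_nf]
  linear_combination (-(f (2 * (2 * s)) * qPoch (-X ^ (3 * s)) (X ^ (3 * s + s)) *
    qPoch (-X ^ s) (X ^ (3 * s + s)))) * h3 - f (2 * (2 * s)) * f (2 * s) *
    qPoch (X ^ s) (X ^ (2 * s)) * h1 + f (2 * (2 * s)) * f (2 * s) * h2 + f (2 * s) * h4

/-- The two linear products are `(-q^s; q^s)_∞` without the factors whose exponent is a multiple of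
`3s`. -/
theorem jacobiProd_one_two (hs : 0 < s) :
    jacobiProd 1 (2 * s) s * f s * f (6 * s) = f (2 * s) * f (3 * s) ^ 2 := by
  have h1 : qPoch (-X ^ s) (X ^ s) = qPoch (-X ^ s) (X ^ (2 * s + s)) *
      qPoch (-X ^ (2 * s)) (X ^ (2 * s + s)) * qPoch (-X ^ (3 * s)) (X ^ (3 * s)) := by
    rw [qPoch_eq_mul_mul (X_dvd_X_pow hs).neg_right (X_dvd_X_pow hs)]
    ring_nf
  have h2 := qPoch_neg_X_pow_mul_f hs
  have h3 := qPoch_neg_X_pow_mul_f (s := 3 * s) (by omega)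
  rw [show 2 * (3 * s) = 6 * s by ring] at h3
  simp only [jacobiProd, Units.val_one, inv_one, one_mul]
  rw [show f (2 * s + s) = f (3 * s) by ring_nf]
  linear_combination (-(f (3 * s) * qPoch (-X ^ (2 * s)) (X ^ (2 * s + s)) *
    qPoch (-X ^ s) (X ^ (2 * s + s)) * f s)) * h3 - f (3 * s) ^ 2 * f s * h1 + f (3 * s) ^ 2 * h2

/-- This is Ramanujan's `φ(-q^s)`. -/
theorem jacobiProd_neg_one_one (hs : 0 < s) : jacobiProd (-1) s s * f (2 * s) = f s ^ 2 := by
  have h := qPoch_X_pow_mul_f hs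
  simp only [jacobiProd, Units.val_neg, Units.val_one, inv_neg, inv_one, neg_mul, one_mul, neg_neg,
    ← two_mul]
  rw [← h]
  ring

/-- The two linear products are `(q^s; q^(2s))_∞` without the factors whose exponent is a multiple
of `3s`. -/
theorem jacobiProd_neg_one_five (hs : 0 < s) :
    jacobiProd (-1) (5 * s) s * f (2 * s) * f (3 * s) = f s * f (6 * s) ^ 2 := by
  have h1 : qPoch (X ^ s) (X ^ (2 * s)) = qPoch (X ^ s) (X ^ (5 * s + s)) *
      qPoch (X ^ (3 * s)) (X ^ (2 * (3 * s))) * qPoch (X ^ (5 * s)) (X ^ (5 * s + s)) := by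
    rw [qPoch_eq_mul_mul (X_dvd_X_pow hs) (X_dvd_X_pow (by omega))]
    ring_nf
  have h2 := qPoch_X_pow_mul_f hs
  have h3 := qPoch_X_pow_mul_f (s := 3 * s) (by omega)
  rw [show f (2 * (3 * s)) = f (6 * s) by ring_nf] at h3
  simp only [jacobiProd, Units.val_neg, Units.val_one, inv_neg, inv_one, neg_mul, one_mul, neg_neg]
  rw [show f (5 * s + s) = f (6 * s) by ring_nf]
  linear_combination (-(f (6 * s) * qPoch (X ^ (5 * s)) (X ^ (5 * s + s)) *
    qPoch (X ^ s) (X ^ (5 * s + s)) * f (2 * s))) * h3 - f (6 * s) ^ 2 * f (2 * s) * h1 +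
    f (6 * s) ^ 2 * h2

end EtaQuotients

theorem jacobiProd_comm_of_inv_eq {u : ℤ⟦X⟧ˣ} (hu : u⁻¹ = u) (a b : ℕ) :
    jacobiProd u a b = jacobiProd u b a := by
  rw [jacobiProd, jacobiProd, hu, add_comm a b]
  ring

/-! ### Dissections of theta series by residue classes. -/

section Residues

variable {M : Type*} [AddCommMonoid M] [TopologicalSpace M] [ContinuousAdd M]

/-- A family over `ℤ` may be summed along representatives `n * l + r i` of the residue classes. -/
theorem hasSum_int_of_residues {ι : Type*} [Fintype ι] [DecidableEq ι] {n : ℤ} (hn : n ≠ 0)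
    {r : ι → ℤ} (hr : ∀ m, ∃! i, n ∣ m - r i) {g : ℤ → M} {s : ι → M}
    (h : ∀ i, HasSum (fun l ↦ g (n * l + r i)) (s i)) : HasSum g (∑ i, s i) := by
  classical
  have hp : ∀ i ∈ Finset.univ, HasSum (fun m ↦ if n ∣ m - r i then g m else 0) (s i) := by
    intro i _
    have hinj : Function.Injective (fun l : ℤ ↦ n * l + r i) := fun x y hxy ↦ by
      simpa [hn] using hxy
    refine (hinj.hasSum_iff fun m hm ↦ ?_).mp ?_
    · refine if_neg fun ⟨l, hl⟩ ↦ hm ⟨l, ?_⟩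
      simp only
      linarith
    · exact (h i).congr_fun fun l ↦ by simp
  refine (hasSum_sum hp).congr_fun fun m ↦ ?_
  obtain ⟨i, hi, hi'⟩ := hr m
  rw [Finset.sum_eq_single i (fun j _ hj ↦ if_neg fun h' ↦ hj (hi' j h')) (by simp), if_pos hi]

end Residues

/-- The representative `-1` is preferred to `2` because the resulting subseries then have triple
product parameters `a, b > 0`; the mod 2 case uses `-1` for the same reason. -/
theorem existsUnique_residue_mod_three (m : ℤ) :
    ∃! i : Fin 3, (3 : ℤ) ∣ m - (![0, 1, -1] : Fin 3 → ℤ) i := by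
  have h : m % 3 = 0 ∨ m % 3 = 1 ∨ m % 3 = 2 := by omega
  rcases h with h | h | h
  · refine ⟨0, ?_, fun i hi ↦ ?_⟩
    · simp; omega
    · fin_cases i <;> simp at hi ⊢ <;> omega
  · refine ⟨1, ?_, fun i hi ↦ ?_⟩
    · simp; omega
    · fin_cases i <;> simp at hi ⊢ <;> omega
  · refine ⟨2, ?_, fun i hi ↦ ?_⟩
    · simp; omega
    · fin_cases i <;> simp at hi ⊢ <;> omega

theorem existsUnique_residue_mod_two (m : ℤ) :
    ∃! i : Fin 2, (2 : ℤ) ∣ m - (![0, -1] : Fin 2 → ℤ) i := by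
  have h : m % 2 = 0 ∨ m % 2 = 1 := by omega
  rcases h with h | h
  · refine ⟨0, ?_, fun i hi ↦ ?_⟩
    · simp; omega
    · fin_cases i <;> (simp at hi ⊢; try omega)
  · refine ⟨1, ?_, fun i hi ↦ ?_⟩
    · simp; omega
    · fin_cases i <;> (simp at hi ⊢; try omega)

/-- The exponents in the Jacobi triple product identity. -/
theorem exists_jacobi_exponent {a b : ℕ} (ha : 0 < a) (hb : 0 < b) :
    ∃ e : ℤ → ℕ, ∀ l : ℤ, 2 * (e l : ℤ) = (a + b : ℕ) * (l * (l - 1)) + 2 * a * l := by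
  have h (l : ℤ) : ∃ e : ℕ, 2 * (e : ℤ) = (a + b : ℕ) * (l * (l - 1)) + 2 * a * l := by
    obtain ⟨c, hc⟩ : (2 : ℤ) ∣ l * (l - 1) := (Int.even_mul_pred_self l).two_dvd
    have hnn : 0 ≤ (a + b : ℕ) * c + a * l := by
      have ha' : (1 : ℤ) ≤ a := by exact_mod_cast ha
      have hb' : (1 : ℤ) ≤ b := by exact_mod_cast hb
      push_cast
      rcases le_or_gt 0 l with h | h
      · have h1 : 0 ≤ c := by
          rcases h.eq_or_lt with h | h
          · subst h; omega
          · have : 0 ≤ l * (l - 1) := mul_nonneg h.le (by omega)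
            omega
        positivity
      · have h1 : 0 ≤ l * (l + 1) := mul_nonneg_of_nonpos_of_nonpos h.le (by omega)
        have h2 : 0 ≤ c + l := by nlinarith
        have h3 : 0 ≤ c := by omega
        nlinarith
    refine ⟨((a + b : ℕ) * c + a * l).toNat, ?_⟩
    rw [Int.toNat_of_nonneg hnn, hc]
    ring
  choose e he using h
  exact ⟨e, he⟩

/-- The 3-dissection of `jacobiProd 1 3 1`. -/
theorem jacobiProd_one_three_one_eq :
    jacobiProd 1 3 1 = jacobiProd 1 21 15 + X ^ 3 * jacobiProd 1 33 3 + X * jacobiProd 1 9 27 := by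
  obtain ⟨e, he⟩ := exists_jacobi_exponent (a := 3) (b := 1) (by omega) (by omega)
  obtain ⟨e0, he0⟩ := exists_jacobi_exponent (a := 21) (b := 15) (by omega) (by omega)
  obtain ⟨e1, he1⟩ := exists_jacobi_exponent (a := 33) (b := 3) (by omega) (by omega)
  obtain ⟨e2, he2⟩ := exists_jacobi_exponent (a := 9) (b := 27) (by omega) (by omega)
  have h := hasSum_jacobiProd 1 (by omega) (by omega) he
  have h0 := hasSum_jacobiProd 1 (by omega) (by omega) he0
  have h1 := (hasSum_jacobiProd 1 (by omega) (by omega) he1).mul_left (X ^ 3)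
  have h2 := (hasSum_jacobiProd 1 (by omega) (by omega) he2).mul_left X
  have h' := hasSum_int_of_residues three_ne_zero existsUnique_residue_mod_three
    (g := fun l ↦ ((1 ^ l : ℤ⟦X⟧ˣ) : ℤ⟦X⟧) * X ^ e l)
    (s := ![jacobiProd 1 21 15, X ^ 3 * jacobiProd 1 33 3, X * jacobiProd 1 9 27]) (by
      intro i
      fin_cases i
      · refine h0.congr_fun fun l ↦ ?_
        simp only [one_zpow]
        congr 2
        have := he (3 * l); have := he0 l; zify; simp; push_cast at *; linarith
      · refine h1.congr_fun fun l ↦ ?_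
        simp only [one_zpow, Units.val_one, one_mul, ← pow_add]
        congr 1
        have := he (3 * l + 1); have := he1 l; zify; simp; push_cast at *; linarith
      · refine h2.congr_fun fun l ↦ ?_
        simp only [one_zpow, Units.val_one, one_mul, ← pow_succ']
        congr 1
        have := he (3 * l + -1); have := he2 l; zify; simp; push_cast at *; linarith)
  simpa [Fin.sum_univ_three] using h.unique h'

/-- The 2-dissection of `jacobiProd 1 6 3`. -/
theorem jacobiProd_one_six_three_eq :
    jacobiProd 1 6 3 = jacobiProd 1 21 15 + X ^ 3 * jacobiProd 1 3 33 := by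
  obtain ⟨e, he⟩ := exists_jacobi_exponent (a := 6) (b := 3) (by omega) (by omega)
  obtain ⟨e0, he0⟩ := exists_jacobi_exponent (a := 21) (b := 15) (by omega) (by omega)
  obtain ⟨e1, he1⟩ := exists_jacobi_exponent (a := 3) (b := 33) (by omega) (by omega)
  have h := hasSum_jacobiProd 1 (by omega) (by omega) he
  have h0 := hasSum_jacobiProd 1 (by omega) (by omega) he0
  have h1 := (hasSum_jacobiProd 1 (by omega) (by omega) he1).mul_left (X ^ 3)
  have h' := hasSum_int_of_residues two_ne_zero existsUnique_residue_mod_two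
    (g := fun l ↦ ((1 ^ l : ℤ⟦X⟧ˣ) : ℤ⟦X⟧) * X ^ e l)
    (s := ![jacobiProd 1 21 15, X ^ 3 * jacobiProd 1 3 33]) (by
      intro i
      fin_cases i
      · refine h0.congr_fun fun l ↦ ?_
        simp only [one_zpow]
        congr 2
        have := he (2 * l); have := he0 l; zify; simp; push_cast at *; linarith
      · refine h1.congr_fun fun l ↦ ?_
        simp only [one_zpow, Units.val_one, one_mul, ← pow_add]
        congr 1
        have := he (2 * l + -1); have := he1 l; zify; simp; push_cast at *; linarith)
  simpa [Fin.sum_univ_two] using h.unique h'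

/-- The 3-dissection of `jacobiProd (-1) 1 1`. -/
theorem jacobiProd_neg_one_one_one_eq :
    jacobiProd (-1) 1 1 = jacobiProd (-1) 9 9 - 2 * X * jacobiProd (-1) 15 3 := by
  obtain ⟨e, he⟩ := exists_jacobi_exponent (a := 1) (b := 1) (by omega) (by omega)
  obtain ⟨e0, he0⟩ := exists_jacobi_exponent (a := 9) (b := 9) (by omega) (by omega)
  obtain ⟨e1, he1⟩ := exists_jacobi_exponent (a := 15) (b := 3) (by omega) (by omega)
  obtain ⟨e2, he2⟩ := exists_jacobi_exponent (a := 3) (b := 15) (by omega) (by omega)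
  have h := hasSum_jacobiProd (-1) (by omega) (by omega) he
  have h0 := hasSum_jacobiProd (-1) (by omega) (by omega) he0
  have h1 := (hasSum_jacobiProd (-1) (by omega) (by omega) he1).mul_left (-X)
  have h2 := (hasSum_jacobiProd (-1) (by omega) (by omega) he2).mul_left (-X)
  have hz (l : ℤ) : ((-1 : ℤ⟦X⟧ˣ) ^ (3 * l)) = (-1) ^ l := by
    rw [zpow_mul]
    norm_num
  have h' := hasSum_int_of_residues three_ne_zero existsUnique_residue_mod_three
    (g := fun l ↦ (((-1) ^ l : ℤ⟦X⟧ˣ) : ℤ⟦X⟧) * X ^ e l)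
    (s := ![jacobiProd (-1) 9 9, -X * jacobiProd (-1) 15 3, -X * jacobiProd (-1) 3 15]) (by
      intro i
      fin_cases i
      · refine h0.congr_fun fun l ↦ ?_
        have h3 : e (3 * l) = e0 l := by
          have := he (3 * l); have := he0 l; zify; push_cast at *; linarith
        simp [hz, h3]
      · refine h1.congr_fun fun l ↦ ?_
        have h3 : e (3 * l + 1) = e1 l + 1 := by
          have := he (3 * l + 1); have := he1 l; zify; push_cast at *; linarith
        simp [zpow_add, hz, h3, pow_succ]
        ring
      · refine h2.congr_fun fun l ↦ ?_
        have h3 : e (3 * l + -1) = e2 l + 1 := by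
          have := he (3 * l + -1); have := he2 l; zify; push_cast at *; linarith
        simp [zpow_add, hz, h3, pow_succ]
        ring)
  have h4 := h.unique h'
  simp only [Fin.sum_univ_three, Matrix.cons_val_zero, Matrix.cons_val_one, Matrix.cons_val] at h4
  -- The classes `1` and `-1` contribute equally, which gives the coefficient 2.
  rw [h4, jacobiProd_comm_of_inv_eq (by simp) 3 15]
  ring

theorem f_ne_zero {k : ℕ} (hk : 0 < k) : f k ≠ 0 := (isUnit_f hk).ne_zero

/-- The 3-dissection of `f 2 ^ 2 / f 1`, with denominators cleared. -/
theorem f_two_sq_dissection :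
    f 2 ^ 2 * (f 3 * f 9 * f 18) = f 1 * (f 6 * f 9 ^ 3 + X * (f 3 * f 18 ^ 3)) := by
  have h1 := jacobiProd_one_three (s := 1) one_pos
  have h2 := jacobiProd_one_three (s := 9) (by omega)
  have h3 := jacobiProd_one_two (s := 3) (by omega)
  have h4 := jacobiProd_one_three_one_eq
  -- The classes `0` and `1` of `ψ(q)` recombine into one theta product, which is an eta quotient by
  -- `h3`.
  have h5 := jacobiProd_one_six_three_eq
  rw [jacobiProd_comm_of_inv_eq (by simp) 3 33] at h5
  rw [jacobiProd_comm_of_inv_eq (by simp) 9 27] at h4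
  norm_num at h1 h2 h3
  linear_combination (-f 3 * f 9 * f 18) * h1 + f 1 * f 3 * f 9 * f 18 * h4
    - f 1 * f 3 * f 9 * f 18 * h5 + f 1 * f 9 * h3 + f 1 * f 3 * f 18 * X * h2

/-- The 3-dissection of `f 1 ^ 2 / f 2`, with denominators cleared. -/
theorem f_one_sq_dissection :
    f 1 ^ 2 * (f 6 * f 9 * f 18) = f 2 * (f 6 * f 9 ^ 3 - 2 * X * (f 3 * f 18 ^ 3)) := by
  have h1 := jacobiProd_neg_one_one (s := 1) one_pos
  have h2 := jacobiProd_neg_one_one (s := 9) (by omega)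
  have h3 := jacobiProd_neg_one_five (s := 3) (by omega)
  have h4 := jacobiProd_neg_one_one_one_eq
  norm_num at h1 h2 h3
  linear_combination (-f 6 * f 9 * f 18) * h1 + f 2 * f 6 * f 9 * f 18 * h4
    + f 2 * f 6 * f 9 * h2 - 2 * X * f 2 * f 18 * h3

/-! ### Norms over the cube roots of unity. -/

/-- The substitution `X ↦ ζ X`, from integral to complex power series. -/
noncomputable def twist (ζ : ℂ) : ℤ⟦X⟧ →+* ℂ⟦X⟧ :=
  (rescale ζ).comp (PowerSeries.map (Int.castRingHom ℂ))

theorem coeff_twist (ζ : ℂ) (n : ℕ) (x : ℤ⟦X⟧) : coeff n (twist ζ x) = ζ ^ n * coeff n x := by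
  simp [twist, coeff_rescale]

theorem twist_X (ζ : ℂ) : twist ζ X = C ζ * X := by
  simp [twist, rescale_X]

theorem twist_injective {ζ : ℂ} (hζ : ζ ≠ 0) : Function.Injective (twist ζ) := by
  intro x y h
  ext n
  have h := congrArg (coeff n) h
  rw [coeff_twist, coeff_twist] at h
  exact_mod_cast mul_left_cancel₀ (pow_ne_zero n hζ) h

theorem continuous_twist (ζ : ℂ) : Continuous (twist ζ) := by
  rw [continuous_iff_continuousAt]
  intro x
  rw [ContinuousAt, WithPiTopology.tendsto_iff_coeff_tendsto]
  intro d
  simp_rw [coeff_twist]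
  exact (continuous_const.mul (continuous_of_discreteTopology.comp
    (WithPiTopology.continuous_coeff ℤ d))).tendsto x

theorem map_qPoch {R : Type*} [CommRing R] [TopologicalSpace R] [T2Space R] {φ : ℤ⟦X⟧ →+* R⟦X⟧}
    (hφ : Continuous φ) {a b : ℤ⟦X⟧} (ha : X ∣ a) (hb : X ∣ b) :
    φ (qPoch a b) = ∏' n : ℕ, (1 - φ a * φ b ^ n) := by
  rw [qPoch, (multipliable_one_sub_mul_pow ha hb).map_tprod φ hφ]
  simp

theorem twist_f_three_mul {ζ : ℂ} (hζ : ζ ^ 3 = 1) {k : ℕ} (hk : 0 < k) :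
    twist ζ (f (3 * k)) = twist 1 (f (3 * k)) := by
  have hX : (X : ℤ⟦X⟧) ∣ X ^ (3 * k) := X_dvd_X_pow (by omega)
  have h (ξ : ℂ) (hξ : ξ ^ 3 = 1) : twist ξ (X ^ (3 * k)) = X ^ (3 * k) := by
    rw [map_pow, twist_X, mul_pow, ← map_pow, pow_mul, hξ, one_pow, map_one, one_mul]
  rw [f, map_qPoch (continuous_twist _) hX hX, map_qPoch (continuous_twist _) hX hX, h ζ hζ,
    h 1 (one_pow 3)]

/-- Factor by factor this is `(1 - y)(1 - ωy)(1 - ω²y) = 1 - y³`; since `3 ∤ i`, `ω ^ i` is again a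
primitive cube root of unity. -/
theorem twist_mul_twist_mul_twist_qPoch {ω : ℂ} (hω : ω ^ 2 + ω + 1 = 0) {i k : ℕ} (hk : 0 < k)
    (hi : ¬ 3 ∣ i) :
    twist 1 (qPoch (X ^ i) (X ^ (3 * k))) * twist ω (qPoch (X ^ i) (X ^ (3 * k))) *
      twist (ω ^ 2) (qPoch (X ^ i) (X ^ (3 * k))) =
    twist 1 (qPoch (X ^ (3 * i)) (X ^ (9 * k))) := by
  have hω3 : ω ^ 3 = 1 := by linear_combination (ω - 1) * hω
  have hωi : (ω ^ i) ^ 2 + ω ^ i + 1 = 0 := by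
    have h := Nat.div_add_mod i 3
    have h1 : ω ^ i = ω ^ (i % 3) := by
      conv_lhs => rw [← h, pow_add, pow_mul, hω3, one_pow, one_mul]
    rcases (by omega : i % 3 = 1 ∨ i % 3 = 2) with h2 | h2
    · rw [h1, h2]
      linear_combination hω
    · rw [h1, h2]
      linear_combination (ω ^ 2 - ω + 1) * hω
  have hXi : (X : ℤ⟦X⟧) ∣ X ^ i := X_dvd_X_pow (by omega)
  have hXk : (X : ℤ⟦X⟧) ∣ X ^ (3 * k) := X_dvd_X_pow (by omega)
  have hXi' : (X : ℂ⟦X⟧) ∣ X ^ i := dvd_pow_self _ (by omega)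
  have hXk' : (X : ℂ⟦X⟧) ∣ X ^ (3 * k) := dvd_pow_self _ (by omega)
  have hm (c : ℂ) : Multipliable fun n : ℕ ↦ (1 : ℂ⟦X⟧) - C c * X ^ i * (X ^ (3 * k)) ^ n :=
    multipliable_one_sub_mul_pow (hXi'.mul_left _) hXk'
  have key (ζ : ℂ) (hζ : ζ ^ 3 = 1) : twist ζ (qPoch (X ^ i) (X ^ (3 * k))) =
      ∏' n : ℕ, (1 - C (ζ ^ i) * X ^ i * (X ^ (3 * k)) ^ n) := by
    rw [map_qPoch (continuous_twist _) hXi hXk]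
    have : C ζ ^ (3 * k) = (1 : ℂ⟦X⟧) := by
      rw [pow_mul, ← map_pow, hζ]; simp
    simp only [map_pow, twist_X, mul_pow, this, one_mul]
  rw [key 1 (by norm_num), key ω hω3, key (ω ^ 2) (by rw [← pow_mul, mul_comm, pow_mul, hω3]; simp),
    map_qPoch (continuous_twist _) (X_dvd_X_pow (by omega)) (X_dvd_X_pow (by omega)),
    ← (hm _).tprod_mul (hm _), ← ((hm _).mul (hm _)).tprod_mul (hm _)]
  refine tprod_congr fun n ↦ ?_
  have hC : (C (ω ^ i) : ℂ⟦X⟧) ^ 2 + C (ω ^ i) + 1 = 0 := by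
    rw [← map_pow, ← map_one C, ← map_add, ← map_add, hωi, map_zero]
  have hC2 : (C ((ω ^ 2) ^ i) : ℂ⟦X⟧) = C (ω ^ i) ^ 2 := by
    rw [← map_pow, ← pow_mul, ← pow_mul, mul_comm]
  have hX1 : twist 1 X = X := by simp [twist_X]
  rw [hC2]
  simp only [one_pow, map_one, one_mul, map_pow, hX1]
  rw [← map_pow]
  generalize (C (ω ^ i) : ℂ⟦X⟧) = c at hC
  have hY : (X : ℂ⟦X⟧) ^ (3 * i) * (X ^ (9 * k)) ^ n = (X ^ i * (X ^ (3 * k)) ^ n) ^ 3 := by ring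
  rw [hY]
  have e1 : c * X ^ i * (X ^ (3 * k)) ^ n = c * (X ^ i * (X ^ (3 * k)) ^ n) := by ring
  have e2 : c ^ 2 * X ^ i * (X ^ (3 * k)) ^ n = c ^ 2 * (X ^ i * (X ^ (3 * k)) ^ n) := by ring
  rw [e1, e2]
  generalize (X : ℂ⟦X⟧) ^ i * (X ^ (3 * k)) ^ n = Y
  linear_combination (-Y + c * Y ^ 2 - (c - 1) * Y ^ 3) * hC

/-- Splitting `f k` by index mod 3, the part `f (3 * k)` is fixed by the twists and contributes its
cube. The other two parts have norms whose product is `f (3 * k) / f (9 * k)`. -/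
theorem twist_mul_twist_mul_twist_f {ω : ℂ} (hω : ω ^ 2 + ω + 1 = 0) {k : ℕ} (hk : ¬ 3 ∣ k) :
    twist 1 (f k) * twist ω (f k) * twist (ω ^ 2) (f k) * twist 1 (f (9 * k)) =
      twist 1 (f (3 * k)) ^ 4 := by
  have hk0 : 0 < k := by omega
  have hω3 : ω ^ 3 = 1 := by linear_combination (ω - 1) * hω
  have hω6 : (ω ^ 2) ^ 3 = 1 := by rw [← pow_mul, mul_comm, pow_mul, hω3]; simp
  have split (j : ℕ) (hj : 0 < j) : f j = qPoch (X ^ j) (X ^ (3 * j)) *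
      qPoch (X ^ (2 * j)) (X ^ (3 * j)) * f (3 * j) := by
    rw [f, f, qPoch_eq_mul_mul (X_dvd_X_pow hj) (X_dvd_X_pow hj)]
    ring_nf
  have h1 := twist_mul_twist_mul_twist_qPoch hω hk0 hk
  have h2 := twist_mul_twist_mul_twist_qPoch hω hk0 (i := 2 * k) (by omega)
  have h3 := congrArg (twist 1) (split (3 * k) (by omega))
  rw [show 3 * (3 * k) = 9 * k by ring, show 2 * (3 * k) = 3 * (2 * k) by ring, map_mul, map_mul,
    ← h1, ← h2] at h3
  rw [split k hk0]
  simp only [map_mul, twist_f_three_mul hω3 hk0, twist_f_three_mul hω6 hk0]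
  linear_combination (-twist 1 (f (3 * k)) ^ 3) * h3

/-- The product of `f_one_sq_dissection` over the substitutions `X ↦ ζ X` with `ζ ^ 3 = 1`. -/
theorem f_three_pow_mul_eq_sub :
    f 3 ^ 8 * f 18 ^ 4 * f 9 = f 6 * ((f 6 * f 9 ^ 3) ^ 3 - 8 * (X * (f 3 * f 18 ^ 3)) ^ 3) := by
  obtain ⟨ω, hω⟩ : ∃ ω : ℂ, ω ^ 2 + ω + 1 = 0 := by
    have h := (Complex.isPrimitiveRoot_exp 3 three_ne_zero).geom_sum_eq_zero (by norm_num)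
    refine ⟨Complex.exp (2 * Real.pi * Complex.I / (3 : ℕ)), Eq.trans ?_ h⟩
    simp only [Finset.sum_range_succ, Finset.sum_range_zero]
    ring
  have hω3 : ω ^ 3 = 1 := by linear_combination (ω - 1) * hω
  have hω6 : (ω ^ 2) ^ 3 = 1 := by rw [← pow_mul, mul_comm, pow_mul, hω3]; simp
  have h1 := twist_mul_twist_mul_twist_f hω (k := 1) (by omega)
  have h2 := twist_mul_twist_mul_twist_f hω (k := 2) (by omega)
  have hd (ζ : ℂ) (hζ : ζ ^ 3 = 1) : twist ζ (f 1) ^ 2 * (twist 1 (f 6) * twist 1 (f 9) *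
      twist 1 (f 18)) = twist ζ (f 2) * (twist 1 (f 6) * twist 1 (f 9) ^ 3 -
      2 * (C ζ * X) * (twist 1 (f 3) * twist 1 (f 18) ^ 3)) := by
    have h := congrArg (twist ζ) f_one_sq_dissection
    have h3 := twist_f_three_mul hζ (k := 1) (by omega)
    have h6 := twist_f_three_mul hζ (k := 2) (by omega)
    have h9 := twist_f_three_mul hζ (k := 3) (by omega)
    have h18 := twist_f_three_mul hζ (k := 6) (by omega)
    norm_num at h3 h6 h9 h18
    have htwo : twist ζ 2 = 2 := map_ofNat _ 2
    simpa [h3, h6, h9, h18, twist_X, htwo] using h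
  have hd0 := hd 1 (by norm_num)
  have hd1 := hd ω hω3
  have hd2 := hd (ω ^ 2) hω6
  have hnz (k : ℕ) (hk : 0 < k) (ζ : ℂ) : twist ζ (f k) ≠ 0 := ((isUnit_f hk).map _).ne_zero
  have hC : (C ω : ℂ⟦X⟧) ^ 2 + C ω + 1 = 0 := by
    rw [← map_pow, ← map_one C, ← map_add, ← map_add, hω, map_zero]
  rw [map_pow] at hd2
  rw [map_one, one_mul] at hd0
  norm_num at h1 h2
  have n2 : twist 1 (f 2) * twist ω (f 2) * twist (ω ^ 2) (f 2) ≠ 0 :=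
    mul_ne_zero (mul_ne_zero (hnz 2 two_pos _) (hnz 2 two_pos _)) (hnz 2 two_pos _)
  refine twist_injective one_ne_zero ?_
  have n6 := hnz 6 (by omega) 1
  have n9 := hnz 9 (by omega) 1
  have n18 := hnz 18 (by omega) 1
  have hX1 : twist 1 X = X := by simp [twist_X]
  simp only [map_mul, map_sub, map_pow, hX1, map_ofNat]
  generalize twist 1 (f 3) = F3 at *
  generalize twist 1 (f 6) = F6 at *
  generalize twist 1 (f 9) = F9 at *
  generalize twist 1 (f 18) = F18 at *
  generalize C ω = c at *
  generalize (X : ℂ⟦X⟧) = x at *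
  have hprod := congrArg₂ (· * ·) (congrArg₂ (· * ·) hd0 hd1) hd2
  set S1 := twist 1 (f 1) * twist ω (f 1) * twist (ω ^ 2) (f 1) with hS1
  set S2 := twist 1 (f 2) * twist ω (f 2) * twist (ω ^ 2) (f 2) with hS2
  have hprod' : S1 ^ 2 * (F6 * F9 * F18) ^ 3 =
      S2 * ((F6 * F9 ^ 3) ^ 3 - 8 * (x * (F3 * F18 ^ 3)) ^ 3) := by
    -- The factorisation of `U³ - (2V)³` over the cube roots of unity.
    have h3 : (F6 * F9 ^ 3 - 2 * x * (F3 * F18 ^ 3)) * (F6 * F9 ^ 3 - 2 * (c * x) * (F3 * F18 ^ 3)) *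
      (F6 * F9 ^ 3 - 2 * (c ^ 2 * x) * (F3 * F18 ^ 3)) =
      (F6 * F9 ^ 3) ^ 3 - 8 * (x * (F3 * F18 ^ 3)) ^ 3 := by
      generalize F6 * F9 ^ 3 = U
      have e (d : ℂ⟦X⟧) : 2 * (d * x) * (F3 * F18 ^ 3) = d * (2 * (x * (F3 * F18 ^ 3))) := by ring
      have e' : 2 * x * (F3 * F18 ^ 3) = 2 * (x * (F3 * F18 ^ 3)) := by ring
      rw [e, e, e']
      generalize x * (F3 * F18 ^ 3) = V
      linear_combination (-(2 * V) * U ^ 2 + c * (2 * V) ^ 2 * U - (c - 1) * (2 * V) ^ 3) * hC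
    rw [← h3, hS1, hS2]
    linear_combination hprod
  -- Multiply by powers of `F9` and `F18` to use `h1` and `h2`, then cancel.
  refine mul_left_cancel₀ (pow_ne_zero 3 n6) ?_
  have h4 : F9 ^ 2 * F18 * (S1 ^ 2 * (F6 * F9 * F18) ^ 3) = F9 ^ 2 * F18 *
    (S2 * ((F6 * F9 ^ 3) ^ 3 - 8 * (x * (F3 * F18 ^ 3)) ^ 3)) := by rw [hprod']
  refine mul_left_cancel₀ (pow_ne_zero 2 n9) ?_
  generalize (F6 * F9 ^ 3) ^ 3 - 8 * (x * (F3 * F18 ^ 3)) ^ 3 = T at *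
  linear_combination h4 - F18 * (F6 * F9 * F18) ^ 3 * (S1 * F9 + F3 ^ 4) * h1 + F9 ^ 2 * T * h2

/-- The square of the dissection of `f₂²/f₁`, times the inverse of `f₁²/f₂` rationalised by `U³ -
8V³ = (U - 2V)(U² + 2UV + 4V²)`. -/
theorem f_two_pow_five_dissection :
    f 2 ^ 5 * (f 3 ^ 10 * f 9 ^ 2 * f 18 ^ 5) = f 1 ^ 4 * f 6 ^ 2 *
      (f 6 * f 9 ^ 3 + X * (f 3 * f 18 ^ 3)) ^ 2 *
      ((f 6 * f 9 ^ 3) ^ 2 + 2 * (f 6 * f 9 ^ 3) * (X * (f 3 * f 18 ^ 3)) +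
        4 * (X * (f 3 * f 18 ^ 3)) ^ 2) := by
  have h1 := f_two_sq_dissection
  have h2 := f_one_sq_dissection
  have h3 := f_three_pow_mul_eq_sub
  rw [mul_assoc 2 X] at h2
  generalize X * (f 3 * f 18 ^ 3) = V at *
  generalize f 6 * f 9 ^ 3 = U at *
  have h4 : f 2 * f 3 ^ 8 * f 18 ^ 3 = f 6 ^ 2 * f 1 ^ 2 * (U ^ 2 + 2 * U * V + 4 * V ^ 2) := by
    refine mul_left_cancel₀ (mul_ne_zero (f_ne_zero (k := 9) (by omega))
      (f_ne_zero (k := 18) (by omega))) ?_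
    linear_combination f 2 * h3 - f 6 * (U ^ 2 + 2 * U * V + 4 * V ^ 2) * h2
  have h5 := congrArg (· ^ 2) h1
  linear_combination f 2 * f 3 ^ 8 * f 18 ^ 3 * h5 + f 1 ^ 2 * (U + V) ^ 2 * h4

/-! ### Extraction of the residue classes mod 3. -/

section Expand

theorem continuous_expand {p : ℕ} (hp : p ≠ 0) :
    Continuous (expand p hp : ℤ⟦X⟧ →ₐ[ℤ] ℤ⟦X⟧) := by
  rw [continuous_iff_continuousAt]
  intro x
  rw [ContinuousAt, WithPiTopology.tendsto_iff_coeff_tendsto]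
  intro d
  simp_rw [coeff_expand]
  split_ifs
  · exact (WithPiTopology.continuous_coeff ℤ _).tendsto x
  · exact tendsto_const_nhds

theorem expand_f {p : ℕ} (hp : p ≠ 0) {k : ℕ} (hk : 0 < k) : expand p hp (f k) = f (p * k) := by
  have h := map_qPoch (φ := (expand p hp : ℤ⟦X⟧ →ₐ[ℤ] ℤ⟦X⟧).toRingHom) (continuous_expand hp)
    (X_dvd_X_pow hk) (X_dvd_X_pow hk)
  rw [f, f, qPoch]
  refine h.trans (tprod_congr fun n ↦ ?_)
  simp [expand_X, pow_mul]

theorem map_ringInverse_of_isUnit {R S F : Type*} [Semiring R] [Semiring S] [FunLike F R S]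
    [RingHomClass F R S] (φ : F) {a : R} (ha : IsUnit a) : φ a⁻¹ʳ = (φ a)⁻¹ʳ := by
  obtain ⟨u, rfl⟩ := ha
  have h : φ (u : R) = (Units.map (φ : R →* S) u : Sˣ) := rfl
  rw [h, Ring.inverse_unit, Ring.inverse_unit, ← map_inv]
  rfl

theorem mk_coeff_eq_of_eq_expand {F A B D : ℤ⟦X⟧}
    (h : F = expand 3 three_ne_zero A + X * expand 3 three_ne_zero B +
      X ^ 2 * expand 3 three_ne_zero D) :
    PowerSeries.mk (fun n ↦ coeff (3 * n) F) = A ∧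
      PowerSeries.mk (fun n ↦ coeff (3 * n + 1) F) = B ∧
      PowerSeries.mk (fun n ↦ coeff (3 * n + 2) F) = D := by
  subst h
  refine ⟨?_, ?_, ?_⟩
  · ext n
    rw [coeff_mk, map_add, map_add, mul_comm X, mul_comm (X ^ 2), coeff_mul_X_pow']
    -- `coeff_succ_mul_X` needs a successor index; at `n = 0` the two shifted summands have no
    -- constant term.
    rcases n with _ | n
    · simp [coeff_expand]
    · rw [show 3 * (n + 1) = 3 * n + 2 + 1 by ring, coeff_succ_mul_X]
      simp only [coeff_expand, if_neg (show ¬ 3 ∣ 3 * n + 2 by omega),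
        if_neg (show ¬ 3 ∣ 3 * n + 2 + 1 - 2 by omega), if_pos (show 3 ∣ 3 * n + 2 + 1 by omega),
        show (3 * n + 2 + 1) / 3 = n + 1 by omega, ite_self, add_zero]
  · ext n
    rw [coeff_mk, map_add, map_add, mul_comm X, mul_comm (X ^ 2), coeff_mul_X_pow',
      coeff_succ_mul_X]
    simp [coeff_expand]
    omega
  · ext n
    rw [coeff_mk, map_add, map_add, mul_comm X, mul_comm (X ^ 2), coeff_mul_X_pow,
      coeff_succ_mul_X]
    simp [coeff_expand]
    omega

end Expand

/-- The quartic `U⁴ + 4U³V + 9U²V² + 10UV³ + 4V⁴`, sorted by the power of `V` mod 3: `U⁴` with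
`10UV³`, `4U³V` with `4V⁴`, and `9U²V²` alone. The common factor in each class is a series in `q³`,
so it is the image of `expand 3`. -/
theorem wGen_eq_expand {t : ℕ} (ht : 0 < t) (h3 : 3 ∣ t) :
    wGen t = expand 3 three_ne_zero (f 2 ^ 4 * f 3 ^ 4 * f 6 * (f 1 ^ 8 * f (t / 3) ^ 2)⁻¹ʳ *
          (f 2 ^ 2 * f 3 ^ 6 * (f 1 ^ 2 * f 6 ^ 6)⁻¹ʳ
            + 10 * X * (f 1 * f 6 ^ 3 * (f 2 * f 3 ^ 3)⁻¹ʳ))) +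
      X * expand 3 three_ne_zero (4 * (f 2 ^ 4 * f 3 ^ 4 * f 6 * (f 1 ^ 8 * f (t / 3) ^ 2)⁻¹ʳ) *
          (f 2 * f 3 ^ 3 * (f 1 * f 6 ^ 3)⁻¹ʳ
            + X * (f 1 ^ 2 * f 6 ^ 6 * (f 2 ^ 2 * f 3 ^ 6)⁻¹ʳ))) +
      X ^ 2 * expand 3 three_ne_zero
        (9 * (f 2 ^ 4 * f 3 ^ 4 * f 6 * (f 1 ^ 8 * f (t / 3) ^ 2)⁻¹ʳ)) := by
  obtain ⟨s, rfl⟩ := h3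
  have hs : 0 < s := by omega
  rw [Nat.mul_div_cancel_left s (by omega)]
  have u (k : ℕ) (hk : 0 < k) (n : ℕ) : IsUnit (f k ^ n) := (isUnit_f hk).pow n
  have u1 : IsUnit (f 1 ^ 8 * f s ^ 2) := (u 1 one_pos 8).mul (u s hs 2)
  have u2 : IsUnit (f 1 ^ 2 * f 6 ^ 6) := (u 1 one_pos 2).mul (u 6 (by omega) 6)
  have u3 : IsUnit (f 2 * f 3 ^ 3) := (isUnit_f two_pos).mul (u 3 (by omega) 3)
  have u4 : IsUnit (f 1 * f 6 ^ 3) := (isUnit_f one_pos).mul (u 6 (by omega) 3)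
  have u5 : IsUnit (f 2 ^ 2 * f 3 ^ 6) := (u 2 two_pos 2).mul (u 3 (by omega) 6)
  have hg : IsUnit (qPoch X (X ^ 2)) := by simpa using isUnit_qPoch one_pos two_pos
  have u0 : IsUnit (qPoch X (X ^ 2) ^ 4 * f (3 * s) ^ 2) := (hg.pow 4).mul (u _ (by omega) 2)
  have hgf : qPoch X (X ^ 2) * f 2 = f 1 := by simpa using qPoch_X_pow_mul_f (s := 1) one_pos
  have main := f_two_pow_five_dissection
  have e1 := expand_f three_ne_zero (k := 1) one_pos
  have e2 := expand_f three_ne_zero (k := 2) two_pos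
  have e3 := expand_f three_ne_zero (k := 3) (by omega)
  have e6 := expand_f three_ne_zero (k := 6) (by omega)
  have es := expand_f three_ne_zero hs
  norm_num at e1 e2 e3 e6
  have c10 : expand 3 three_ne_zero (10 : ℤ⟦X⟧) = 10 := map_ofNat _ 10
  have c4 : expand 3 three_ne_zero (4 : ℤ⟦X⟧) = 4 := map_ofNat _ 4
  have c9 : expand 3 three_ne_zero (9 : ℤ⟦X⟧) = 9 := map_ofNat _ 9
  simp only [map_add, map_mul, map_pow, map_ringInverse_of_isUnit _ u1,
    map_ringInverse_of_isUnit _ u2, map_ringInverse_of_isUnit _ u3, map_ringInverse_of_isUnit _ u4,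
    map_ringInverse_of_isUnit _ u5, e1, e2, e3, e6, es, expand_X, c10, c4, c9]
  have v1 : IsUnit (f 3 ^ 8 * f (3 * s) ^ 2) := (u 3 (by omega) 8).mul (u _ (by omega) 2)
  have v2 : IsUnit (f 3 ^ 2 * f 18 ^ 6) := (u 3 (by omega) 2).mul (u 18 (by omega) 6)
  have v3 : IsUnit (f 6 * f 9 ^ 3) := (isUnit_f (by omega)).mul (u 9 (by omega) 3)
  have v4 : IsUnit (f 3 * f 18 ^ 3) := (isUnit_f (by omega)).mul (u 18 (by omega) 3)
  have v5 : IsUnit (f 6 ^ 2 * f 9 ^ 6) := (u 6 (by omega) 2).mul (u 9 (by omega) 6)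
  -- In the fraction field `⁻¹ʳ` becomes the field inverse, so that `field_simp` applies.
  have hinj : Function.Injective (algebraMap ℤ⟦X⟧ (FractionRing ℤ⟦X⟧)) :=
    IsFractionRing.injective _ _
  have hne (x : ℤ⟦X⟧) (hx : IsUnit x) : algebraMap ℤ⟦X⟧ (FractionRing ℤ⟦X⟧) x ≠ 0 :=
    (hx.map _).ne_zero
  refine hinj ?_
  rw [wGen]
  change algebraMap ℤ⟦X⟧ (FractionRing ℤ⟦X⟧)
    (f 2 * (qPoch X (X ^ 2) ^ 4 * f (3 * s) ^ 2)⁻¹ʳ) = _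
  have main' := congrArg (algebraMap ℤ⟦X⟧ (FractionRing ℤ⟦X⟧)) main
  have hgf' := congrArg (algebraMap ℤ⟦X⟧ (FractionRing ℤ⟦X⟧)) hgf
  have n1 := hne _ (isUnit_f (k := 1) (by omega))
  have n2 := hne _ (isUnit_f (k := 2) (by omega))
  have n3 := hne _ (isUnit_f (k := 3) (by omega))
  have n6 := hne _ (isUnit_f (k := 6) (by omega))
  have n9 := hne _ (isUnit_f (k := 9) (by omega))
  have n18 := hne _ (isUnit_f (k := 18) (by omega))
  have ns := hne _ (isUnit_f (k := 3 * s) (by omega))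
  have ng := hne _ hg
  simp only [map_add, map_mul, map_pow, map_ofNat, map_ringInverse_of_isUnit _ u0,
    map_ringInverse_of_isUnit _ v1, map_ringInverse_of_isUnit _ v2, map_ringInverse_of_isUnit _ v3,
    map_ringInverse_of_isUnit _ v4, map_ringInverse_of_isUnit _ v5, Ring.inverse_eq_inv']
    at main' hgf' ⊢
  generalize algebraMap ℤ⟦X⟧ (FractionRing ℤ⟦X⟧) (f 1) = F1 at *
  generalize algebraMap ℤ⟦X⟧ (FractionRing ℤ⟦X⟧) (f 2) = F2 at *
  generalize algebraMap ℤ⟦X⟧ (FractionRing ℤ⟦X⟧) (f 3) = F3 at *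
  generalize algebraMap ℤ⟦X⟧ (FractionRing ℤ⟦X⟧) (f 6) = F6 at *
  generalize algebraMap ℤ⟦X⟧ (FractionRing ℤ⟦X⟧) (f 9) = F9 at *
  generalize algebraMap ℤ⟦X⟧ (FractionRing ℤ⟦X⟧) (f 18) = F18 at *
  generalize algebraMap ℤ⟦X⟧ (FractionRing ℤ⟦X⟧) (f (3 * s)) = Fs at *
  generalize algebraMap ℤ⟦X⟧ (FractionRing ℤ⟦X⟧) (qPoch X (X ^ 2)) = g at *
  generalize algebraMap ℤ⟦X⟧ (FractionRing ℤ⟦X⟧) X = x at *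
  -- `f_two_pow_five_dissection` divided through, with `F1 = g * F2` eliminating `F1`.
  have hq : F2 * (g ^ 4 * Fs ^ 2)⁻¹ = F6 ^ 2 * (F6 * F9 ^ 3 + x * (F3 * F18 ^ 3)) ^ 2 *
      ((F6 * F9 ^ 3) ^ 2 + 2 * (F6 * F9 ^ 3) * (x * (F3 * F18 ^ 3)) +
        4 * (x * (F3 * F18 ^ 3)) ^ 2) * (F3 ^ 10 * F9 ^ 2 * F18 ^ 5 * Fs ^ 2)⁻¹ := by
    rw [← div_eq_mul_inv, ← div_eq_mul_inv, div_eq_div_iff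
      (mul_ne_zero (pow_ne_zero _ ng) (pow_ne_zero _ ns)) (by positivity)]
    subst hgf'
    refine mul_left_cancel₀ (pow_ne_zero 4 n2) ?_
    linear_combination Fs ^ 2 * main'
  rw [hq]
  field_simp
  ring

theorem mainTheorem2 (t : ℕ) (ht : 0 < t) (h3 : 3 ∣ t) :
    PowerSeries.mk (fun n ↦ w t (3 * n)) =
        f 2 ^ 4 * f 3 ^ 4 * f 6 * (f 1 ^ 8 * f (t / 3) ^ 2)⁻¹ʳ *
          (f 2 ^ 2 * f 3 ^ 6 * (f 1 ^ 2 * f 6 ^ 6)⁻¹ʳ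
            + 10 * X * (f 1 * f 6 ^ 3 * (f 2 * f 3 ^ 3)⁻¹ʳ)) ∧
      PowerSeries.mk (fun n ↦ w t (3 * n + 1)) =
        4 * (f 2 ^ 4 * f 3 ^ 4 * f 6 * (f 1 ^ 8 * f (t / 3) ^ 2)⁻¹ʳ) *
          (f 2 * f 3 ^ 3 * (f 1 * f 6 ^ 3)⁻¹ʳ
            + X * (f 1 ^ 2 * f 6 ^ 6 * (f 2 ^ 2 * f 3 ^ 6)⁻¹ʳ)) ∧
      PowerSeries.mk (fun n ↦ w t (3 * n + 2)) =
        9 * (f 2 ^ 4 * f 3 ^ 4 * f 6 * (f 1 ^ 8 * f (t / 3) ^ 2)⁻¹ʳ) ∧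
      (∀ n : ℕ, w t (3 * n + 1) ≡ 0 [ZMOD 4]) ∧
      (∀ n : ℕ, w t (3 * n + 2) ≡ 0 [ZMOD 9]) := by
  obtain ⟨hA, hB, hD⟩ := mk_coeff_eq_of_eq_expand (wGen_eq_expand ht h3)
  have hconst (c : ℤ) (p : ℤ⟦X⟧) (n : ℕ) : coeff n ((c : ℤ⟦X⟧) * p) ≡ 0 [ZMOD c] := by
    rw [Int.modEq_zero_iff_dvd, ← zsmul_eq_mul, map_zsmul]
    simp
  refine ⟨hA, hB, hD, fun n ↦ ?_, fun n ↦ ?_⟩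
  · have h := congrArg (coeff n) hB
    rw [coeff_mk, mul_assoc 4] at h
    rw [w, h]
    exact_mod_cast hconst 4 _ n
  · have h := congrArg (coeff n) hD
    rw [coeff_mk] at h
    rw [w, h]
    exact_mod_cast hconst 9 _ n
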